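/- Definitions. A chip firing game (CFG) $CFG(G,\mathcal O)$ consists of a finite directed multigraph $G$ with $E(u,v)\in\mathbb N$ edges from $u$ to $v$ and an initial configuration $\mathcal O:V(G)\to\mathbb N$. Put $\deg^+(v)=\sum_{w}E(v,w)$. A vertex $v$ is a sink if $\deg^+(v)=E(v,v)$, that is, if it has no outgoing edges other than loops. In a configuration $c:V(G)\to\mathbb N$ a vertex $v$ is firable if it is not a sink and $c(v)\ge\deg^+(v)$; firing it moves one chip from $v$ along each outgoing edge of $v$. The configurations reachable from $\mathcal O$ by finite (possibly empty) sequences of firings are ordered by $c_1\le c_2$ iff $c_1$ can be transformed into $c_2$ by a finite (possibly empty) sequence of firings. A finite lattice is upper locally distributive (ULD) if for each $x\ne\mathbf 1$ the interval $[x,x^+]$, where $x^+$ is the join of the upper covers of $x$, is isomorphic to the lattice of all subsets of a finite set. The game generates a finite ULD lattice $L$ if it reaches a unique fixed point (a configuration without firable vertices) and the ordered set of reachable configurations is isomorphic to $L$. Two CFGs are equivalent if they generate isomorphic lattices. A CFG is simple if every vertex is fired at most once in every execution from $\mathcal O$ to the fixed point. A CFG is an Abelian Sandpile model (ASM) if $G$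 is connected (as an undirected graph), has exactly one sink $s$, and $E(u,v)=E(v,u)$ for all distinct vertices $u,v\ne s$. Let $L(ACFG)$ and $L(ASM)$ be the classes of lattices generated by CFGs on directed acyclic graphs and by ASMs, respectively. Theorem. Every CFG on a directed acyclic graph is equivalent to a simple CFG on a directed acyclic graph, and it is also equivalent to an ASM. Consequently $L(ACFG)\subseteq L(ASM)$. -/

import Mathlib

universe u v

/-- A finite directed multigraph (the support graph), given by the number `E x y` of edges from
`x` to `y` (`E x x` is the number of loops at `x`), with an initial configuration of chips. -/
structure ChipFiringGame where
  /-- the vertices of the support graph -/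
  V : Type u
  [fintypeV : Fintype V]
  /-- the number of edges from one vertex to another -/
  E : V → V → ℕ
  /-- the initial configuration -/
  init : V → ℕ

namespace ChipFiringGame

attribute [instance] ChipFiringGame.fintypeV

variable (C : ChipFiringGame.{u})

/-- The out-degree of a vertex, loops included. -/
def outDeg (x : C.V) : ℕ := ∑ y, C.E x y

/-- A sink is a vertex without outgoing edges, except possibly loops. -/
def IsSink (x : C.V) : Prop := C.outDeg x = C.E x x

/-- A vertex is firable if it has an outgoing edge and at least as many chips as its
out-degree. -/
def Firable (c : C.V → ℕ) (x : C.V) : Prop := ¬ C.IsSink x ∧ C.outDeg x ≤ c x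

open Classical in
/-- Firing `x` moves one chip from `x` along each outgoing edge of `x`. (The subtraction is a true
one whenever `x` is firable.) -/
noncomputable def fire (c : C.V → ℕ) (x : C.V) : C.V → ℕ :=
  fun y => (if y = x then c y - C.outDeg x else c y) + C.E x y

/-- `C.Exec c l d`: firing the vertices of the list `l` one after the other, each of them being
firable when its turn comes, is an execution from the configuration `c` to `d`. -/
inductive Exec : (C.V → ℕ) → List C.V → (C.V → ℕ) → Prop
  | nil (c : C.V → ℕ) : Exec c [] c
  | cons {c d : C.V → ℕ} {x : C.V} {l : List C.V} :
      C.Firable c x → Exec (C.fire c x) l d → Exec c (x :: l) d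

/-- `c` can be transformed into `d` by a possibly empty sequence of firings. -/
def Reach (c d : C.V → ℕ) : Prop := ∃ l : List C.V, C.Exec c l d

/-- No firing is possible in `c`. -/
def IsFixedPoint (c : C.V → ℕ) : Prop := ∀ x, ¬ C.Firable c x

/-- The game reaches a unique fixed point. -/
def ReachesFixedPoint : Prop := ∃! c : C.V → ℕ, C.Reach C.init c ∧ C.IsFixedPoint c

/-- The configuration space: all configurations reachable from the initial one. -/
def Space : Type u := {c : C.V → ℕ // C.Reach C.init c}

variable {C} in
theorem Exec.append {c d e : C.V → ℕ} {l m : List C.V} (h : C.Exec c l d) (k : C.Exec d m e) :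
    C.Exec c (l ++ m) e := by
  induction h with
  | nil => exact k
  | cons hx _ ih => exact Exec.cons hx (ih k)

/-- The configuration space is ordered by `c ≤ d` iff `c` can be transformed into `d`. -/
instance : Preorder C.Space where
  le c d := C.Reach c.1 d.1
  le_refl c := ⟨[], Exec.nil c.1⟩
  le_trans := by
    rintro c d e ⟨l, hl⟩ ⟨m, hm⟩
    exact ⟨l ++ m, hl.append hm⟩

/-- The game is simple: every vertex is fired at most once in every execution from the initial
configuration to the fixed point. -/
def IsSimple : Prop :=
  ∀ (l : List C.V) (c : C.V → ℕ), C.Exec C.init l c → C.IsFixedPoint c → l.Nodup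

/-- The support graph has no directed cycle (in particular, no loop). -/
def IsAcyclic : Prop := ∀ x : C.V, ¬ Relation.TransGen (fun y z => 0 < C.E y z) x x

/-- The game is an Abelian Sandpile model: the support graph is connected (as an undirected graph),
has exactly one sink, and between any two distinct vertices other than the sink there are as many
edges in one direction as in the other. -/
def IsASM : Prop :=
  (SimpleGraph.fromRel fun x y => 0 < C.E x y).Connected ∧
    ∃ s : C.V, (∀ x, C.IsSink x ↔ x = s) ∧
      ∀ x y, x ≠ y → x ≠ s → y ≠ s → C.E x y = C.E y x

end ChipFiringGame

/-- Upper local distributivity of a lattice (used for finite lattices): for every `x` other than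
the maximum, if `y` is the join of the upper covers of `x`, then the interval `[x, y]` is a
hypercube, that is, isomorphic to the lattice of all subsets of a finite set. -/
def IsULD (L : Type v) [Lattice L] : Prop :=
  ∀ x y : L, ¬ IsMax x → IsLUB {z | x ⋖ z} y → ∃ n : ℕ, Nonempty (Set.Icc x y ≃o Set (Fin n))

namespace ChipFiringGame

/-- The game generates the lattice `L`: it reaches a unique fixed point, and its configuration
space is isomorphic to the finite upper locally distributive lattice `L`. -/
def Generates (C : ChipFiringGame.{u}) (L : Type v) [Lattice L] : Prop :=
  C.ReachesFixedPoint ∧ Finite L ∧ IsULD L ∧ Nonempty (C.Space ≃o L)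

/-- Two games are equivalent if they generate the same lattice, up to isomorphism. -/
def Equivalent (C D : ChipFiringGame.{u}) : Prop :=
  ∃ (L : Type u) (_ : Lattice L), C.Generates L ∧ D.Generates L

end ChipFiringGame

/-- `L` belongs to the class of lattices generated by games on directed acyclic graphs. -/
def MemLACFG (L : Type v) [Lattice L] : Prop :=
  ∃ C : ChipFiringGame.{u}, C.IsAcyclic ∧ C.Generates L

/-- `L` belongs to the class of lattices generated by Abelian Sandpile models. -/
def MemLASM (L : Type v) [Lattice L] : Prop :=
  ∃ C : ChipFiringGame.{u}, C.IsASM ∧ C.Generates L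

/-!
A game on an acyclic graph is governed by its vectors of firing numbers. Whether a vertex `x` can be
fired next depends only on how often `x` and its predecessors have been fired, and firing other
vertices never disables `x`. This gives an abelian `FiringSystem`, in which the feasible vectors
satisfy the exchange property `Feasible.exists_enabled`. Hence they are closed under componentwise
maxima, reachability among them is the componentwise order, and above each of them the enabled
letters span a hypercube (`State.isULD`). If configurations determine the vectors leading to them,
the configuration space is isomorphic to this lattice (`Generates.of_state_orderIso`). On an acyclic
graph this holds by recursion along the edges, which also bounds all firing numbers by some `K`.

A simple game for the same lattice has a vertex `(x, i)` for each `i < K`, standing for firing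
number `i + 1` of `x`. Each `(x, i)` has so many edges to one common sink that it can be fired at
most once, and its initial chips are chosen so that it lacks exactly a prescribed threshold
(`thresholdGame`). Heavy edges from `(x, i)` to `(x, i + 1)` force the copies of `x` to be fired in
order, and the other edges copy those of the given graph (`unrollThreshold_le_iff`).

To turn this game into a sandpile model, add the reversals of all edges between vertices other than
the sink. The chips flowing backwards do no harm if the edges and the threshold at each vertex are
first multiplied by a factor that decreases rapidly along the edges: what flows back to a vertex is
then less than the unit in which its threshold is measured (`scale_mul_le_sum_symmWeight_iff`).
-/

/-! ### Firing systems and their lattices of states -/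

/-- An abelian firing rule on a set `W` of letters. A vector `n : W → ℕ` records how often each
letter has been fired. Whether `w` may be fired next depends on `n` only, and firing other letters
never disables `w`. -/
structure FiringSystem (W : Type u) where
  /-- `Enabled n w`: the letter `w` may be fired after the firings counted by `n` -/
  Enabled : (W → ℕ) → W → Prop
  /-- firing letters other than `w` does not disable `w` -/
  mono : ∀ {n m : W → ℕ} {w : W}, n ≤ m → n w = m w → Enabled n w → Enabled m w

namespace FiringSystem

variable {W : Type u}

open Classical in
/-- The vector of firing numbers after one more firing of `w`. -/
noncomputable def bump (n : W → ℕ) (w : W) : W → ℕ := Function.update n w (n w + 1)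

@[simp] theorem bump_self (n : W → ℕ) (w : W) : bump n w w = n w + 1 := by simp [bump]

theorem bump_of_ne (n : W → ℕ) {w x : W} (h : x ≠ w) : bump n w x = n x := by simp [bump, h]

theorem le_bump (n : W → ℕ) (w : W) : n ≤ bump n w := by
  intro x
  by_cases h : x = w
  · subst h; simp
  · rw [bump_of_ne n h]

theorem bump_le {n m : W → ℕ} {w : W} (h : n ≤ m) (hw : n w < m w) : bump n w ≤ m := by
  intro x
  by_cases hx : x = w
  · subst hx; simpa using hw
  · rw [bump_of_ne n hx]; exact h x

theorem eq_or_eq_bump {n m : W → ℕ} {w : W} (h : n ≤ m) (h' : m ≤ bump n w) :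
    m = n ∨ m = bump n w := by
  by_cases hw : n w < m w
  · exact Or.inr (le_antisymm h' (bump_le h hw))
  · left
    funext x
    have h1 : n x ≤ m x := h x
    have h2 : m x ≤ bump n w x := h' x
    by_cases hx : x = w
    · subst hx; omega
    · rw [bump_of_ne n hx] at h2; omega

/-- If each firing of `x` contributes `e x`, then one more firing of `w` adds `e w` to the sum. -/
theorem sum_bump_mul [Fintype W] (n : W → ℕ) (w : W) (e : W → ℕ) :
    ∑ x, bump n w x * e x = (∑ x, n x * e x) + e w := by
  classical
  rw [← Finset.add_sum_erase _ _ (Finset.mem_univ w),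
    ← Finset.add_sum_erase _ (fun x => n x * e x) (Finset.mem_univ w)]
  have : ∑ x ∈ Finset.univ.erase w, bump n w x * e x = ∑ x ∈ Finset.univ.erase w, n x * e x :=
    Finset.sum_congr rfl fun x hx => by rw [bump_of_ne n (Finset.ne_of_mem_erase hx)]
  rw [this, bump_self]
  ring

variable (S : FiringSystem W)

/-- One legal firing. -/
def Step (n m : W → ℕ) : Prop := ∃ w, S.Enabled n w ∧ m = bump n w

/-- `m` arises from `n` by legal firings. -/
def Path : (W → ℕ) → (W → ℕ) → Prop := Relation.ReflTransGen S.Step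

/-- The vectors of firing numbers of the legal firing sequences. -/
def Feasible (n : W → ℕ) : Prop := S.Path 0 n

variable {S}

theorem Path.le {n m : W → ℕ} (h : S.Path n m) : n ≤ m := by
  induction h with
  | refl => exact le_rfl
  | tail _ h ih =>
    obtain ⟨w, _, rfl⟩ := h
    exact ih.trans (le_bump _ _)

theorem Feasible.zero : S.Feasible 0 := Relation.ReflTransGen.refl

theorem Feasible.path {n m : W → ℕ} (hn : S.Feasible n) (h : S.Path n m) : S.Feasible m :=
  Relation.ReflTransGen.trans hn h

theorem Feasible.bump {n : W → ℕ} {w : W} (hn : S.Feasible n) (h : S.Enabled n w) :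
    S.Feasible (bump n w) :=
  hn.path (Relation.ReflTransGen.single ⟨w, h, rfl⟩)

@[elab_as_elim]
theorem Feasible.induction {P : ∀ n, S.Feasible n → Prop} (zero : P 0 Feasible.zero)
    (step : ∀ n w (hn : S.Feasible n) (hw : S.Enabled n w), P n hn → P _ (hn.bump hw))
    {n : W → ℕ} (hn : S.Feasible n) : P n hn := by
  induction hn with
  | refl => exact zero
  | tail h h' ih =>
    obtain ⟨w, hw, rfl⟩ := h'
    exact step _ w h hw ih

/-- The exchange property: the first firing on the way to `m` that leaves the vectors below `n`
is also possible at `n`. -/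
theorem Feasible.exists_enabled {n m : W → ℕ} (hm : S.Feasible m) (h : ¬ m ≤ n) :
    ∃ w, S.Enabled n w ∧ n w < m w := by
  induction hm using Feasible.induction with
  | zero => exact absurd (fun _ => Nat.zero_le _) h
  | step p w _ hw ih =>
    by_cases hp : p ≤ n
    · have hpw : p w = n w := by
        refine le_antisymm (hp w) (not_lt.1 fun hlt => h (bump_le hp hlt))
      exact ⟨w, S.mono hp hpw hw, by simp [hpw]⟩
    · obtain ⟨x, hx, hlt⟩ := ih hp
      exact ⟨x, hx, hlt.trans_le (le_bump p w x)⟩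

/-- Repeatedly firing letters in which `n` is still below `m`, one gets
from `n` to `n ⊔ m`. -/
theorem Feasible.path_sup [Fintype W] {m : W → ℕ} (hm : S.Feasible m) (n : W → ℕ) :
    S.Path n (n ⊔ m) := by
  induction hk : ∑ x, (m x - n x) using Nat.strong_induction_on generalizing n with
  | _ k ih =>
    by_cases hmn : m ≤ n
    · rw [sup_eq_left.2 hmn]
      exact Relation.ReflTransGen.refl
    · obtain ⟨w, hw, hlt⟩ := hm.exists_enabled hmn
      have hsup : FiringSystem.bump n w ⊔ m = n ⊔ m :=
        le_antisymm (sup_le (bump_le le_sup_left (lt_sup_of_lt_right hlt)) le_sup_right)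
          (sup_le_sup_right (le_bump n w) m)
      have hdec : ∑ x, (m x - FiringSystem.bump n w x) < k := by
        rw [← hk]
        refine Finset.sum_lt_sum (fun x _ => Nat.sub_le_sub_left (le_bump n w x) _)
          ⟨w, Finset.mem_univ w, ?_⟩
        rw [bump_self]
        omega
      have := ih _ hdec _ rfl
      rw [hsup] at this
      exact Relation.ReflTransGen.head ⟨w, hw, rfl⟩ this

theorem Feasible.sup [Fintype W] {n m : W → ℕ} (hn : S.Feasible n) (hm : S.Feasible m) :
    S.Feasible (n ⊔ m) :=
  hn.path (hm.path_sup n)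

/-- Between feasible vectors, reachability is the componentwise order. -/
theorem Feasible.path_iff_le [Fintype W] {n m : W → ℕ} (hm : S.Feasible m) :
    S.Path n m ↔ n ≤ m :=
  ⟨Path.le, fun h => by simpa [sup_eq_right.2 h] using hm.path_sup n⟩

open Classical in
/-- Distinct enabled letters can be fired in any order, so every set of them can be fired. -/
theorem Feasible.add_indicator [Fintype W] {n : W → ℕ} (hn : S.Feasible n) (B : Finset W)
    (hB : ∀ w ∈ B, S.Enabled n w) : S.Feasible (fun x => n x + if x ∈ B then 1 else 0) := by
  induction B using Finset.induction_on with
  | empty => simpa using hn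
  | insert w B hwB ih =>
    have h1 := ih fun x hx => hB x (Finset.mem_insert_of_mem hx)
    have h2 : S.Enabled (fun x => n x + if x ∈ B then 1 else 0) w :=
      S.mono (fun x => Nat.le_add_right _ _) (by simp [hwB]) (hB w (Finset.mem_insert_self w B))
    convert h1.bump h2 using 1
    funext x
    by_cases hx : x = w
    · subst hx; simp [hwB]
    · rw [bump_of_ne _ hx]; simp [hx]

variable (S) in
/-- The feasible vectors, ordered componentwise. -/
def State : Type u := {n : W → ℕ // S.Feasible n}

namespace State

instance : PartialOrder S.State := inferInstanceAs (PartialOrder {n : W → ℕ // S.Feasible n})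

theorem le_def {a b : S.State} : a ≤ b ↔ a.1 ≤ b.1 := Iff.rfl

theorem finite_of_bounded [Finite W] {K : ℕ} (hK : ∀ n, S.Feasible n → ∀ w, n w ≤ K) :
    Finite S.State := by
  refine Finite.of_injective (β := W → Fin (K + 1))
    (fun a w => ⟨a.1 w, Nat.lt_succ_of_le (hK a.1 a.2 w)⟩) fun a b h => ?_
  refine Subtype.ext (funext fun w => ?_)
  simpa using congrFun h w

theorem covBy_bump (a : S.State) {w : W} (hw : S.Enabled a.1 w) :
    a ⋖ ⟨bump a.1 w, a.2.bump hw⟩ := by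
  have hlt : a.1 w < bump a.1 w w := by simp
  refine ⟨lt_of_le_not_ge (le_bump a.1 w) fun h => absurd (h w) (not_le.2 hlt), fun c hac hcb => ?_⟩
  rcases eq_or_eq_bump (w := w) hac.le hcb.le with h | h
  · exact hac.ne (Subtype.ext h.symm)
  · exact hcb.ne (Subtype.ext h)

variable [Fintype W]

theorem exists_isLUB [Finite S.State] (s : Set S.State) : ∃ a, IsLUB s a := by
  induction s, s.toFinite using Set.Finite.induction_on with
  | empty => exact ⟨⟨0, Feasible.zero⟩, fun _ h => h.elim, fun _ _ _ => Nat.zero_le _⟩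
  | @insert c s _ _ ih =>
    obtain ⟨a, ha⟩ := ih
    have hca : IsLUB {c, a} (⟨c.1 ⊔ a.1, c.2.sup a.2⟩ : S.State) := by
      refine ⟨?_, fun b hb => ?_⟩
      · rintro b (rfl | rfl)
        · exact le_sup_left (a := b.1)
        · exact le_sup_right (b := b.1)
      · exact sup_le (a := c.1) (hb (Or.inl rfl)) (hb (Or.inr rfl))
    refine ⟨_, fun b hb => ?_, fun b hb => hca.2 ?_⟩
    · rcases hb with rfl | hb
      · exact hca.1 (Or.inl rfl)
      · exact (ha.1 hb).trans (hca.1 (Or.inr rfl))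
    · rintro d (rfl | rfl)
      · exact hb (Or.inl rfl)
      · exact ha.2 fun x hx => hb (Or.inr hx)

/-- The states of a finite firing system form a lattice: joins are componentwise. -/
noncomputable instance [Finite S.State] : Lattice S.State :=
  letI : SupSet S.State := ⟨fun s => (exists_isLUB s).choose⟩
  (completeLatticeOfSup S.State fun s => (exists_isLUB s).choose_spec).toLattice

theorem exists_eq_bump_of_covBy {a b : S.State} (h : a ⋖ b) :
    ∃ w, S.Enabled a.1 w ∧ b.1 = bump a.1 w := by
  obtain ⟨w, hw, hlt⟩ := b.2.exists_enabled (n := a.1) h.lt.not_ge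
  refine ⟨w, hw, ?_⟩
  have hle : (⟨bump a.1 w, a.2.bump hw⟩ : S.State) ≤ b := bump_le (m := b.1) h.le hlt
  by_contra hne
  exact h.2 (covBy_bump a hw).lt (lt_of_le_of_ne hle fun h => hne (congrArg Subtype.val h).symm)

open Classical in
/-- Above a state `a`, the join of the upper covers is obtained by firing each enabled letter once,
and the states in between correspond to the sets of enabled letters. -/
theorem isULD [Finite S.State] : IsULD S.State := by
  intro a y hmax hy
  let A : Finset W := Finset.univ.filter fun w => S.Enabled a.1 w
  have hA : ∀ w, w ∈ A ↔ S.Enabled a.1 w := fun w => by simp [A]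
  let add (B : Finset W) : W → ℕ := fun x => a.1 x + if x ∈ B then 1 else 0
  have hadd : ∀ B : Finset W, B ⊆ A → S.Feasible (add B) := fun B hB =>
    a.2.add_indicator B fun w hw => (hA w).1 (hB hw)
  let t : S.State := ⟨add A, hadd A subset_rfl⟩
  have hat : a ≤ t := fun x => Nat.le_add_right _ _
  have hub : t ∈ upperBounds {z | a ⋖ z} := by
    intro z hz
    obtain ⟨w, hw, hzw⟩ := exists_eq_bump_of_covBy hz
    refine le_def.2 (hzw ▸ bump_le hat ?_)
    change a.1 w < a.1 w + _
    simp [(hA w).2 hw]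
  have hlub : t ∈ lowerBounds (upperBounds {z | a ⋖ z}) := by
    intro z hz x
    -- an upper cover exists because `a` is not maximal; it shows that `a ≤ z`
    obtain ⟨c, hc⟩ : ∃ c, ¬ c ≤ a := by
      by_contra! h
      exact hmax fun c _ => h c
    obtain ⟨w, hw, _⟩ := c.2.exists_enabled hc
    have haz : a ≤ z := (covBy_bump a hw).le.trans (hz (covBy_bump a hw))
    change a.1 x + (if x ∈ A then 1 else 0) ≤ z.1 x
    by_cases hx : x ∈ A
    · have := hz (covBy_bump a ((hA x).1 hx)) x
      simpa [hx] using this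
    · simpa [hx] using haz x
  obtain rfl : y = t := hy.unique ⟨hub, hlub⟩
  have hmem : ∀ B : Set A, add (B.toFinset.map (Function.Embedding.subtype _)) ≤ add A ∧
      S.Feasible (add (B.toFinset.map (Function.Embedding.subtype _))) := by
    intro B
    have hBA : B.toFinset.map (Function.Embedding.subtype (· ∈ A)) ⊆ A := by
      intro x hx
      obtain ⟨y, _, rfl⟩ := Finset.mem_map.1 hx
      exact y.2
    refine ⟨fun x => ?_, hadd _ hBA⟩
    refine Nat.add_le_add_left ?_ _
    by_cases hx : x ∈ B.toFinset.map (Function.Embedding.subtype (· ∈ A))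
    · simp [hx, hBA hx]
    · simp only [if_neg hx]; exact Nat.zero_le _
  have hval : ∀ (B : Set A) (x : A),
      add (B.toFinset.map (Function.Embedding.subtype _)) x = a.1 x + if x ∈ B then 1 else 0 := by
    intro B x
    simp [add]
  let e : Set A ≃o Set.Icc a t :=
    { toFun := fun B => ⟨⟨_, (hmem B).2⟩, fun x => Nat.le_add_right _ _, (hmem B).1⟩
      invFun := fun b => {x | a.1 x < b.1.1 x}
      left_inv := by
        intro B
        ext x
        change a.1 x < add _ x ↔ _
        rw [hval]
        by_cases hx : x ∈ B <;> simp [hx]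
      right_inv := by
        rintro ⟨b, hb1, hb2⟩
        refine Subtype.ext (Subtype.ext (funext fun x => ?_))
        have h1 : a.1 x ≤ b.1 x := hb1 x
        have h2 : b.1 x ≤ a.1 x + if x ∈ A then 1 else 0 := hb2 x
        by_cases hx : x ∈ A
        · change add _ ((⟨x, hx⟩ : A) : W) = _
          rw [hval]
          simp only [hx, if_true] at h2
          simp only [Set.mem_ofPred_eq]
          split_ifs <;> omega
        · simp only [hx, if_false] at h2
          simp only [add, Finset.mem_map, Function.Embedding.subtype_apply, Subtype.exists,
            exists_and_right, exists_eq_right, hx, IsEmpty.exists_iff, if_false]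
          omega
      map_rel_iff' := by
        intro B B'
        refine ⟨fun h x hx => ?_, fun h x => Nat.add_le_add_left ?_ _⟩
        · have h' : add _ (x : W) ≤ add _ (x : W) := h x
          rw [hval, hval] at h'
          by_contra hx'
          simp [hx, hx'] at h'
        · by_cases hx : x ∈ B.toFinset.map (Function.Embedding.subtype _)
          · have : x ∈ B'.toFinset.map (Function.Embedding.subtype _) :=
              Finset.map_subset_map.2 (Set.toFinset_mono h) hx
            simp [hx, this]
          · simp only [if_neg hx]; exact Nat.zero_le _ }
  exact ⟨A.card, ⟨e.symm.trans (A.equivFin.toOrderIsoSet)⟩⟩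

end State

/-- Two firing systems have isomorphic sets of states if a map `f` that reflects the order on the
feasible vectors matches their legal firings. -/
theorem nonempty_state_orderIso {W' : Type u} {S : FiringSystem W} {T : FiringSystem W'}
    (f : (W → ℕ) → W' → ℕ) (h0 : f 0 = 0)
    (hle : ∀ n m, S.Feasible n → S.Feasible m → (f n ≤ f m ↔ n ≤ m))
    (hstep : ∀ n w, S.Feasible n → S.Enabled n w →
      ∃ w', T.Enabled (f n) w' ∧ f (bump n w) = bump (f n) w')
    (hback : ∀ n w', S.Feasible n → T.Enabled (f n) w' →
      ∃ w, S.Enabled n w ∧ f (bump n w) = bump (f n) w') :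
    Nonempty (S.State ≃o T.State) := by
  have hf : ∀ n, S.Feasible n → T.Feasible (f n) := by
    intro n hn
    induction hn using Feasible.induction with
    | zero => rw [h0]; exact Feasible.zero
    | step n w hn hw ih =>
      obtain ⟨w', hw', h⟩ := hstep n w hn hw
      exact h ▸ ih.bump hw'
  have hsurj : ∀ m, T.Feasible m → ∃ n, S.Feasible n ∧ f n = m := by
    intro m hm
    induction hm using Feasible.induction with
    | zero => exact ⟨0, Feasible.zero, h0⟩
    | step m w' _ hw' ih =>
      obtain ⟨n, hn, rfl⟩ := ih
      obtain ⟨w, hw, h⟩ := hback n w' hn hw'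
      exact ⟨_, hn.bump hw, h⟩
  let g : S.State ↪o T.State := OrderEmbedding.ofMapLEIff (fun a => ⟨f a.1, hf _ a.2⟩)
    fun a b => hle a.1 b.1 a.2 b.2
  refine ⟨RelIso.ofSurjective g fun b => ?_⟩
  obtain ⟨n, hn, h⟩ := hsurj b.1 b.2
  exact ⟨⟨n, hn⟩, Subtype.ext h⟩

end FiringSystem

/-! ### The firing system of a chip firing game -/

namespace ChipFiringGame

open FiringSystem

variable (C : ChipFiringGame.{u})

/-- The firing system of a game: after the firings counted by `n`, the vertex `x` is firable iff the
chips it has had so far pay for its previous firings and for one more. -/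
def system : FiringSystem C.V where
  Enabled n x := ¬ C.IsSink x ∧ (n x + 1) * C.outDeg x ≤ C.init x + ∑ y, n y * C.E y x
  mono := by
    rintro n m x hnm hx ⟨h1, h2⟩
    refine ⟨h1, hx ▸ h2.trans (Nat.add_le_add_left ?_ _)⟩
    exact Finset.sum_le_sum fun y _ => Nat.mul_le_mul_right _ (hnm y)

/-- The configuration after the firings counted by `n`. For feasible `n` the subtraction is a true
one. -/
def config (n : C.V → ℕ) : C.V → ℕ :=
  fun x => C.init x + (∑ y, n y * C.E y x) - n x * C.outDeg x

theorem config_zero : C.config 0 = C.init := by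
  funext x
  simp [config]

variable {C}

/-- Nonnegativity of the number of chips. -/
theorem mul_outDeg_le {n : C.V → ℕ} (hn : C.system.Feasible n) (x : C.V) :
    n x * C.outDeg x ≤ C.init x + ∑ y, n y * C.E y x := by
  induction hn using Feasible.induction with
  | zero => simp
  | step n w _ hw ih =>
    rw [sum_bump_mul]
    by_cases hx : x = w
    · subst hx
      rw [bump_self]
      exact hw.2.trans (by omega)
    · rw [bump_of_ne n hx]
      omega

theorem config_add {n : C.V → ℕ} (hn : C.system.Feasible n) (x : C.V) :
    C.config n x + n x * C.outDeg x = C.init x + ∑ y, n y * C.E y x :=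
  Nat.sub_add_cancel (mul_outDeg_le hn x)

theorem firable_config_iff {n : C.V → ℕ} (hn : C.system.Feasible n) (x : C.V) :
    C.Firable (C.config n) x ↔ C.system.Enabled n x := by
  have h := config_add hn x
  refine and_congr_right fun _ => ?_
  rw [← h, add_mul]
  omega

theorem fire_config {n : C.V → ℕ} (hn : C.system.Feasible n) {x : C.V}
    (hx : C.system.Enabled n x) : C.fire (C.config n) x = C.config (bump n x) := by
  funext y
  have h1 := config_add hn y
  have h2 := config_add (hn.bump hx) y
  rw [sum_bump_mul] at h2
  by_cases hy : y = x
  · subst hy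
    have h3 := ((firable_config_iff hn y).2 hx).2
    rw [bump_self, add_mul] at h2
    simp only [fire, if_true]
    omega
  · rw [bump_of_ne n hy] at h2
    simp only [fire, hy, if_false]
    omega

open Classical in
/-- An execution adds its numbers of firings to the vector of firings. -/
theorem Exec.exists_path {c d : C.V → ℕ} {l : List C.V} (h : C.Exec c l d) :
    ∀ n, C.system.Feasible n → c = C.config n →
      ∃ m, C.system.Path n m ∧ d = C.config m ∧ ∀ x, m x = n x + l.count x := by
  induction h with
  | nil c => exact fun n _ hc => ⟨n, Relation.ReflTransGen.refl, hc, by simp⟩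
  | @cons c d x l hx _ ih =>
    rintro n hn rfl
    have hx' := (firable_config_iff hn x).1 hx
    obtain ⟨m, hm, hd, hcount⟩ := ih _ (hn.bump hx') (fire_config hn hx')
    refine ⟨m, Relation.ReflTransGen.head ⟨x, hx', rfl⟩ hm, hd, fun y => ?_⟩
    rw [hcount]
    by_cases hy : y = x
    · subst hy
      rw [bump_self, List.count_cons_self]
      omega
    · rw [bump_of_ne n hy, List.count_cons_of_ne (Ne.symm hy)]

theorem reach_of_path {n m : C.V → ℕ} (hn : C.system.Feasible n) (h : C.system.Path n m) :
    C.Reach (C.config n) (C.config m) := by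
  induction h with
  | refl => exact ⟨[], Exec.nil _⟩
  | @tail p q hp hpq ih =>
    obtain ⟨x, hx, rfl⟩ := hpq
    obtain ⟨l, hl⟩ := ih
    have hpf : C.system.Feasible p := hn.path hp
    refine ⟨l ++ [x], hl.append (Exec.cons ((firable_config_iff hpf x).2 hx) ?_)⟩
    rw [fire_config hpf hx]
    exact Exec.nil _

theorem reach_init_iff {c : C.V → ℕ} :
    C.Reach C.init c ↔ ∃ n, C.system.Feasible n ∧ c = C.config n := by
  constructor
  · rintro ⟨l, hl⟩
    obtain ⟨m, hm, hc, -⟩ := hl.exists_path 0 Feasible.zero C.config_zero.symm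
    exact ⟨m, hm, hc⟩
  · rintro ⟨n, hn, rfl⟩
    exact C.config_zero ▸ reach_of_path Feasible.zero hn

/-- A game with finitely many feasible vectors ends in exactly one fixed point. -/
theorem reachesFixedPoint [Finite C.system.State] : C.ReachesFixedPoint := by
  obtain ⟨t, ht⟩ := State.exists_isLUB (Set.univ : Set C.system.State)
  have hfix : ∀ n, C.system.Feasible n → (C.IsFixedPoint (C.config n) ↔ n = t.1) := by
    intro n hn
    have hnt : n ≤ t.1 := ht.1 (Set.mem_univ (⟨n, hn⟩ : C.system.State))
    constructor
    · refine fun h => le_antisymm hnt ?_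
      by_contra hlt
      obtain ⟨w, hw, _⟩ := t.2.exists_enabled hlt
      exact h w ((firable_config_iff hn w).2 hw)
    · rintro rfl w hw
      have hw' := (firable_config_iff hn w).1 hw
      have : FiringSystem.bump t.1 w w ≤ t.1 w :=
        ht.1 (Set.mem_univ (⟨_, hn.bump hw'⟩ : C.system.State)) w
      simp at this
  refine ⟨C.config t.1, ⟨reach_init_iff.2 ⟨_, t.2, rfl⟩, (hfix _ t.2).2 rfl⟩, ?_⟩
  rintro c ⟨hc, hcf⟩
  obtain ⟨n, hn, rfl⟩ := reach_init_iff.1 hc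
  rw [(hfix n hn).1 hcf]

/-- If feasible vectors are determined by the configurations they lead to, then the configuration
space is isomorphic to the set of feasible vectors. -/
theorem nonempty_state_orderIso_space
    (hinj : ∀ n m, C.system.Feasible n → C.system.Feasible m → C.config n = C.config m → n = m) :
    Nonempty (C.system.State ≃o C.Space) := by
  let g : C.system.State → C.Space := fun a => ⟨C.config a.1, reach_init_iff.2 ⟨_, a.2, rfl⟩⟩
  have hg : Function.Bijective g := by
    constructor
    · intro a b h
      exact Subtype.ext (hinj _ _ a.2 b.2 (congrArg Subtype.val h))
    · rintro ⟨c, hc⟩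
      obtain ⟨n, hn, rfl⟩ := reach_init_iff.1 hc
      exact ⟨⟨n, hn⟩, rfl⟩
  refine ⟨{ Equiv.ofBijective g hg with map_rel_iff' := ?_ }⟩
  intro a b
  change C.Reach (C.config a.1) (C.config b.1) ↔ a.1 ≤ b.1
  constructor
  · rintro ⟨l, hl⟩
    obtain ⟨m, hm, hbm, -⟩ := hl.exists_path a.1 a.2 rfl
    rw [hinj b.1 m b.2 (a.2.path hm) hbm]
    exact hm.le
  · exact fun h => reach_of_path a.2 (b.2.path_iff_le.2 h)

theorem Generates.of_state_orderIso {L : Type v} [Lattice L] [Finite L] (hL : IsULD L)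
    (hinj : ∀ n m, C.system.Feasible n → C.system.Feasible m → C.config n = C.config m → n = m)
    (e : C.system.State ≃o L) : C.Generates L := by
  have : Finite C.system.State := Finite.of_equiv L e.symm.toEquiv
  obtain ⟨g⟩ := nonempty_state_orderIso_space hinj
  exact ⟨reachesFixedPoint, inferInstance, hL, ⟨g.symm.trans e⟩⟩

end ChipFiringGame

/-! ### Threshold games -/

open FiringSystem ChipFiringGame

variable {W : Type u} [Fintype W]

/-- The number of edges from each vertex of a threshold game to the sink. It exceeds all thresholds
and all amounts of chips that a vertex can receive. -/
def sinkWeight (b : W → W → ℕ) (θ : W → ℕ) : ℕ := 1 + ∑ x, θ x + ∑ x, ∑ y, b y x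

/-- The game with edges `b` between the vertices in `W` and a sink `none`, in which `some x` lacks
exactly `θ x` chips for being firable. The subtraction is a true one by `lt_sinkWeight`. -/
def thresholdGame (b : W → W → ℕ) (θ : W → ℕ) : ChipFiringGame.{u} where
  V := Option W
  E
    | some x, some y => b x y
    | some _, none => sinkWeight b θ
    | none, _ => 0
  init
    | some x => sinkWeight b θ + ∑ y, b x y - θ x
    | none => 0

namespace thresholdGame

variable (b : W → W → ℕ) (θ : W → ℕ)

theorem lt_sinkWeight (x : W) : θ x < sinkWeight b θ := by
  have := Finset.single_le_sum (f := θ) (fun _ _ => Nat.zero_le _) (Finset.mem_univ x)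
  unfold sinkWeight
  omega

theorem sum_lt_sinkWeight (x : W) : ∑ y, b y x < sinkWeight b θ := by
  have := Finset.single_le_sum (f := fun x => ∑ y, b y x) (fun _ _ => Nat.zero_le _)
    (Finset.mem_univ x)
  unfold sinkWeight
  omega

theorem sum_mul_lt_sinkWeight {n : W → ℕ} (hn : ∀ x, n x ≤ 1) (x : W) :
    ∑ y, n y * b y x < sinkWeight b θ := by
  refine lt_of_le_of_lt (Finset.sum_le_sum fun y _ => ?_) (sum_lt_sinkWeight b θ x)
  exact (Nat.mul_le_mul_right _ (hn y)).trans (one_mul _).le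

theorem outDeg_some (x : W) :
    (thresholdGame b θ).outDeg (some x) = sinkWeight b θ + ∑ y, b x y :=
  Fintype.sum_option fun y : Option W => (thresholdGame b θ).E (some x) y

theorem init_add (x : W) :
    (thresholdGame b θ).init (some x) + θ x = (thresholdGame b θ).outDeg (some x) := by
  rw [outDeg_some]
  have := lt_sinkWeight b θ x
  exact Nat.sub_add_cancel (by omega)

theorem sum_mul_E (n : Option W → ℕ) (x : W) :
    ∑ y, n y * (thresholdGame b θ).E y (some x) = ∑ y, n (some y) * b y x := by
  refine (Fintype.sum_option fun y : Option W => n y * (thresholdGame b θ).E y (some x)).trans ?_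
  change n none * 0 + _ = _
  rw [mul_zero, zero_add]
  rfl

theorem isSink_iff (x : Option W) : (thresholdGame b θ).IsSink x ↔ x = none := by
  cases x with
  | none => exact iff_of_true (Finset.sum_eq_zero fun _ _ => rfl) rfl
  | some x =>
    refine iff_of_false (fun h => ?_) (by simp)
    have h' : (thresholdGame b θ).outDeg (some x) = b x x := h
    rw [outDeg_some] at h'
    have h1 := lt_sinkWeight b θ x
    have h2 := Finset.single_le_sum (f := b x) (fun _ _ => Nat.zero_le _) (Finset.mem_univ x)
    omega

/-- The meaning of the thresholds: `some x` can be fired once, as soon as it has received `θ x`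
chips. After that it can never pay for a second firing, because of its edges to the sink. -/
theorem enabled_some_iff {n : Option W → ℕ} (hn : ∀ x, n x ≤ 1) (x : W) :
    (thresholdGame b θ).system.Enabled n (some x) ↔
      n (some x) = 0 ∧ θ x ≤ ∑ y, n (some y) * b y x := by
  change ¬ (thresholdGame b θ).IsSink (some x) ∧ (n (some x) + 1) * (thresholdGame b θ).outDeg _ ≤
    (thresholdGame b θ).init (some x) + ∑ y, n y * (thresholdGame b θ).E y (some x) ↔ _
  rw [isSink_iff, sum_mul_E, ← init_add]
  have h1 := init_add b θ x
  rw [outDeg_some] at h1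
  have h2 := sum_mul_lt_sinkWeight b θ (n := fun y => n (some y)) (fun y => hn _) x
  have h3 := hn (some x)
  rcases Nat.le_one_iff_eq_zero_or_eq_one.1 h3 with h | h
  · rw [h]
    simp
  · rw [h]
    simp
    omega

theorem not_enabled_none (n : Option W → ℕ) : ¬ (thresholdGame b θ).system.Enabled n none :=
  fun h => h.1 ((isSink_iff b θ none).2 rfl)

theorem le_one_of_feasible {n : Option W → ℕ} (hn : (thresholdGame b θ).system.Feasible n)
    (x : Option W) : n x ≤ 1 := by
  induction hn using Feasible.induction generalizing x with
  | zero => exact Nat.zero_le _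
  | step n w _ hw ih =>
    by_cases hx : x = w
    · subst hx
      cases x with
      | none => exact absurd hw (not_enabled_none b θ n)
      | some x => exact by rw [bump_self, ((enabled_some_iff b θ ih x).1 hw).1]
    · exact (bump_of_ne n hx).trans_le (ih x)

theorem none_of_feasible {n : Option W → ℕ} (hn : (thresholdGame b θ).system.Feasible n) :
    n none = 0 := by
  induction hn using Feasible.induction with
  | zero => rfl
  | step n w _ hw ih =>
    refine (bump_of_ne n ?_).trans ih
    rintro rfl
    exact not_enabled_none b θ n hw

/-- A vertex other than the sink has been fired iff it holds fewer chips than initially. -/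
theorem config_injOn (n m : Option W → ℕ) (hn : (thresholdGame b θ).system.Feasible n)
    (hm : (thresholdGame b θ).system.Feasible m)
    (h : (thresholdGame b θ).config n = (thresholdGame b θ).config m) : n = m := by
  have key : ∀ k : Option W → ℕ, (thresholdGame b θ).system.Feasible k → ∀ x : W,
      k (some x) = if (thresholdGame b θ).config k (some x) < (thresholdGame b θ).init (some x)
        then 1 else 0 := by
    intro k hk x
    have h1 : (thresholdGame b θ).config k (some x) +
        k (some x) * (thresholdGame b θ).outDeg (some x) =
          (thresholdGame b θ).init (some x) + ∑ y, k y * (thresholdGame b θ).E y (some x) :=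
      config_add hk (some x)
    have h2 := sum_mul_lt_sinkWeight b θ (n := fun y => k (some y))
      (fun y => le_one_of_feasible b θ hk _) x
    rw [sum_mul_E, outDeg_some] at h1
    rcases Nat.le_one_iff_eq_zero_or_eq_one.1 (le_one_of_feasible b θ hk (some x)) with h0 | h0 <;>
      rw [h0] at h1 ⊢ <;> split_ifs <;> omega
  funext x
  cases x with
  | none => rw [none_of_feasible b θ hn, none_of_feasible b θ hm]
  | some x => rw [key n hn, key m hm, h]

theorem isSimple : (thresholdGame b θ).IsSimple := by
  classical
  intro l c hl _
  obtain ⟨m, hm, -, hcount⟩ := hl.exists_path 0 Feasible.zero (config_zero _).symm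
  refine List.nodup_iff_count_le_one.2 fun x => ?_
  have h1 := hcount x
  have h2 : m x ≤ 1 := le_one_of_feasible b θ hm x
  have h3 : m x = l.count x := by
    rw [h1, Pi.zero_apply, zero_add]
  omega

end thresholdGame

theorem ChipFiringGame.isAcyclic_of_rank {C : ChipFiringGame.{u}} (r : C.V → ℕ)
    (hr : ∀ x y, 0 < C.E x y → r x < r y) : C.IsAcyclic := by
  intro x hx
  have : ∀ y, Relation.TransGen (fun y z => 0 < C.E y z) x y → r x < r y := by
    intro y hy
    induction hy with
    | single h => exact hr _ _ h
    | tail _ h ih => exact ih.trans (hr _ _ h)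
  exact lt_irrefl _ (this x hx)

theorem thresholdGame.isAcyclic {b : W → W → ℕ} {θ : W → ℕ} (r : W → ℕ)
    (hr : ∀ x y, 0 < b x y → r x < r y) : (thresholdGame b θ).IsAcyclic := by
  refine isAcyclic_of_rank (C := thresholdGame b θ)
    (fun x : Option W => x.elim (1 + ∑ y, r y) r) ?_
  rintro (_ | x) (_ | y) h
  · exact absurd h (lt_irrefl 0)
  · exact absurd h (lt_irrefl 0)
  · have := Finset.single_le_sum (f := r) (fun _ _ => Nat.zero_le _) (Finset.mem_univ x)
    change r x < 1 + ∑ y, r y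
    omega
  · exact hr x y h

theorem thresholdGame.isASM {b : W → W → ℕ} {θ : W → ℕ} (hb : ∀ x y, b x y = b y x) :
    (thresholdGame b θ).IsASM := by
  refine ⟨?_, none, isSink_iff b θ, ?_⟩
  · have hadj : ∀ x : Option W, (SimpleGraph.fromRel fun x y : Option W =>
        0 < (thresholdGame b θ).E x y).Reachable x none := by
      rintro (_ | x)
      · exact SimpleGraph.Reachable.refl _
      · refine SimpleGraph.Adj.reachable ((SimpleGraph.fromRel_adj _ _ _).2 ⟨by simp, Or.inl ?_⟩)
        exact (Nat.zero_le _).trans_lt (lt_sinkWeight b θ x)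
    exact (SimpleGraph.connected_iff _).2
      ⟨fun x y => (hadj x).trans (hadj y).symm, ⟨(none : Option W)⟩⟩
  · rintro (_ | x) (_ | y) _ hx hy
    · rfl
    · exact absurd rfl hx
    · exact absurd rfl hy
    · exact hb x y

/-! ### Symmetrizing the weights of an acyclic threshold game -/

/-- The factor by which the threshold at a vertex of rank `r x` is scaled. It decreases so fast
along the edges that all chips flowing backwards to `x` amount to less than `scale a r x`. -/
def scale (a : W → W → ℕ) (r : W → ℕ) (x : W) : ℕ :=
  (1 + ∑ x, ∑ y, a x y) ^ (∑ y, r y - r x)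

/-- Scaled edges, together with their reversals. -/
def symmWeight (a : W → W → ℕ) (r : W → ℕ) (x y : W) : ℕ :=
  scale a r y * a x y + scale a r x * a y x

theorem sum_backward_lt_scale {a : W → W → ℕ} {r : W → ℕ} (hr : ∀ x y, 0 < a x y → r x < r y)
    (x : W) : ∑ y, scale a r y * a x y < scale a r x := by
  have hB : ∑ y, a x y < 1 + ∑ x, ∑ y, a x y := by
    have := Finset.single_le_sum (f := fun x => ∑ y, a x y) (fun _ _ => Nat.zero_le _)
      (Finset.mem_univ x)
    omega
  have hpos : 0 < scale a r x := Nat.pow_pos (by omega)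
  refine lt_of_mul_lt_mul_left (a := 1 + ∑ x, ∑ y, a x y) ?_ (Nat.zero_le _)
  calc (1 + ∑ x, ∑ y, a x y) * ∑ y, scale a r y * a x y
      ≤ ∑ y, scale a r x * a x y := by
        rw [Finset.mul_sum]
        refine Finset.sum_le_sum fun y _ => ?_
        rcases Nat.eq_zero_or_pos (a x y) with h | h
        · simp [h]
        · rw [← mul_assoc]
          refine Nat.mul_le_mul_right _ ?_
          have h1 := hr x y h
          have h2 := Finset.single_le_sum (f := r) (fun _ _ => Nat.zero_le _) (Finset.mem_univ y)
          unfold scale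
          rw [← pow_succ']
          exact Nat.pow_le_pow_right (by omega) (by omega)
    _ = scale a r x * ∑ y, a x y := (Finset.mul_sum _ _ _).symm
    _ < scale a r x * (1 + ∑ x, ∑ y, a x y) := Nat.mul_lt_mul_of_pos_left hB hpos
    _ = _ := mul_comm _ _

/-- Symmetrizing an acyclic family of weights does not affect which thresholds are reached. -/
theorem scale_mul_le_sum_symmWeight_iff {a : W → W → ℕ} {r : W → ℕ}
    (hr : ∀ x y, 0 < a x y → r x < r y) {n : W → ℕ} (hn : ∀ x, n x ≤ 1) (x : W) (t : ℕ) :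
    scale a r x * t ≤ ∑ y, n y * symmWeight a r y x ↔ t ≤ ∑ y, n y * a y x := by
  have hsum : ∑ y, n y * symmWeight a r y x =
      scale a r x * (∑ y, n y * a y x) + ∑ y, n y * (scale a r y * a x y) := by
    rw [Finset.mul_sum, ← Finset.sum_add_distrib]
    exact Finset.sum_congr rfl fun y _ => by unfold symmWeight; ring
  have hlt : ∑ y, n y * (scale a r y * a x y) < scale a r x := by
    refine lt_of_le_of_lt (Finset.sum_le_sum fun y _ => ?_) (sum_backward_lt_scale hr x)
    exact (Nat.mul_le_mul_right _ (hn y)).trans (one_mul _).le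
  rw [hsum]
  constructor
  · intro h
    refine Nat.lt_succ_iff.1 (lt_of_mul_lt_mul_left (a := scale a r x) ?_ (Nat.zero_le _))
    rw [Nat.succ_eq_add_one, mul_add, mul_one]
    omega
  · intro h
    exact (Nat.mul_le_mul_left _ h).trans (Nat.le_add_right _ _)

/-! ### Unrolling an acyclic game -/

namespace ChipFiringGame

variable {C : ChipFiringGame.{u}}

theorem IsAcyclic.exists_rank (h : C.IsAcyclic) :
    ∃ r : C.V → ℕ, ∀ x y, 0 < C.E x y → r x < r y := by
  classical
  refine ⟨fun y => (Finset.univ.filter fun x =>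
    Relation.TransGen (fun y z => 0 < C.E y z) x y).card, fun x y hxy => Finset.card_lt_card ?_⟩
  refine (Finset.ssubset_iff_of_subset fun z hz => ?_).2 ⟨x, ?_, ?_⟩
  · simp only [Finset.mem_filter, Finset.mem_univ, true_and] at hz ⊢
    exact hz.tail hxy
  · simpa using Relation.TransGen.single (r := fun y z => 0 < C.E y z) hxy
  · simpa using h x

theorem outDeg_pos {x : C.V} (h : ¬ C.IsSink x) : 0 < C.outDeg x := by
  have h1 : C.E x x ≤ C.outDeg x :=
    Finset.single_le_sum (f := C.E x) (fun _ _ => Nat.zero_le _) (Finset.mem_univ x)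
  have h2 : C.outDeg x ≠ C.E x x := h
  omega

theorem eq_zero_of_isSink {n : C.V → ℕ} (hn : C.system.Feasible n) {x : C.V} (hx : C.IsSink x) :
    n x = 0 := by
  induction hn using Feasible.induction with
  | zero => rfl
  | step n w _ hw ih =>
    refine (bump_of_ne n ?_).trans ih
    rintro rfl
    exact hw.1 hx

/-- In an acyclic game, the firings of a vertex are bounded in terms of those of its
predecessors. -/
theorem exists_bound {r : C.V → ℕ} (hr : ∀ x y, 0 < C.E x y → r x < r y) :
    ∃ K, ∀ n, C.system.Feasible n → ∀ x, n x ≤ K := by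
  have key : ∀ k, ∃ K, ∀ n, C.system.Feasible n → ∀ x, r x < k → n x ≤ K := by
    intro k
    induction k with
    | zero => exact ⟨0, fun _ _ x hx => absurd hx (Nat.not_lt_zero _)⟩
    | succ k ih =>
      obtain ⟨K, hK⟩ := ih
      -- a vertex of rank `k` only receives chips from vertices that are fired at most `K` times
      refine ⟨∑ x, (C.init x + ∑ y, K * C.E y x), fun n hn x hx => ?_⟩
      by_cases hs : C.IsSink x
      · rw [eq_zero_of_isSink hn hs]
        exact Nat.zero_le _
      · calc n x ≤ n x * C.outDeg x := Nat.le_mul_of_pos_right _ (outDeg_pos hs)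
          _ ≤ C.init x + ∑ y, n y * C.E y x := mul_outDeg_le hn x
          _ ≤ C.init x + ∑ y, K * C.E y x := by
            refine Nat.add_le_add_left (Finset.sum_le_sum fun y _ => ?_) _
            rcases Nat.eq_zero_or_pos (C.E y x) with h | h
            · simp [h]
            · have := hr y x h
              exact Nat.mul_le_mul_right _ (hK n hn y (by omega))
          _ ≤ _ := Finset.single_le_sum (f := fun x => C.init x + ∑ y, K * C.E y x)
            (fun _ _ => Nat.zero_le _) (Finset.mem_univ x)
  obtain ⟨K, hK⟩ := key (1 + ∑ x, r x)
  refine ⟨K, fun n hn x => hK n hn x ?_⟩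
  have := Finset.single_le_sum (f := r) (fun _ _ => Nat.zero_le _) (Finset.mem_univ x)
  omega

/-- In an acyclic game, the number of chips at a vertex and the firings of its predecessors
determine how often it has been fired. -/
theorem config_injOn_of_rank {r : C.V → ℕ} (hr : ∀ x y, 0 < C.E x y → r x < r y) (n m : C.V → ℕ)
    (hn : C.system.Feasible n) (hm : C.system.Feasible m) (h : C.config n = C.config m) :
    n = m := by
  funext x
  induction hk : r x using Nat.strong_induction_on generalizing x with
  | _ k ih =>
    by_cases hs : C.IsSink x
    · rw [eq_zero_of_isSink hn hs, eq_zero_of_isSink hm hs]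
    · have h1 := config_add hn x
      have h2 := config_add hm x
      have hsum : ∑ y, n y * C.E y x = ∑ y, m y * C.E y x := by
        refine Finset.sum_congr rfl fun y _ => ?_
        rcases Nat.eq_zero_or_pos (C.E y x) with h | h
        · simp [h]
        · rw [ih (r y) (hk ▸ hr y x h) y rfl]
      rw [hsum, ← h2, h] at h1
      exact Nat.eq_of_mul_eq_mul_right (outDeg_pos hs) (Nat.add_left_cancel h1)

variable (C) (K : ℕ)

/-- A number of edges exceeding the number of chips a vertex can receive if no vertex is fired more
than `K` times. -/
def linkWeight : ℕ := 1 + ∑ x, ∑ y, K * C.E y x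

open Classical in
/-- The weights of the unrolled game, whose vertex `(x, i)` stands for the firing of `x` that comes
after `i` others. Every firing of `x` sends the chips that `x` sends, and prepares its successor
`(x, i + 1)`. -/
noncomputable def unrollWeight (p q : C.V × Fin K) : ℕ :=
  C.E p.1 q.1 + if p.1 = q.1 ∧ p.2.val + 1 = q.2.val then C.linkWeight K else 0

open Classical in
/-- The thresholds of the unrolled game: `(x, i)` needs the chips that `x` lacks for its firing
number `i + 1` (none if its initial chips suffice), and, for `0 < i`, the
link from `(x, i - 1)`. Copies of sinks get a threshold that is never reached. -/
noncomputable def unrollThreshold (p : C.V × Fin K) : ℕ :=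
  if C.IsSink p.1 then 2 * C.linkWeight K
  else (p.2.val + 1) * C.outDeg p.1 - C.init p.1 + if 0 < p.2.val then C.linkWeight K else 0

/-- The vertices of the unrolled game that are fired when each `x` is fired `n x` times. -/
def unroll (n : C.V → ℕ) : Option (C.V × Fin K) → ℕ
  | some p => if p.2.val < n p.1 then 1 else 0
  | none => 0

variable {C K}

theorem unroll_le_one (n : C.V → ℕ) (p : Option (C.V × Fin K)) : C.unroll K n p ≤ 1 := by
  cases p with
  | none => exact Nat.zero_le _
  | some p => simp only [unroll]; split_ifs <;> simp

theorem unroll_zero : C.unroll K 0 = 0 := by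
  funext p
  cases p <;> simp [unroll]

theorem unroll_le_iff {n m : C.V → ℕ} (hn : ∀ x, n x ≤ K) :
    C.unroll K n ≤ C.unroll K m ↔ n ≤ m := by
  constructor
  · intro h x
    by_contra hx
    have hx' : m x < n x := not_le.1 hx
    have := h (some (x, ⟨m x, hx'.trans_le (hn x)⟩))
    simp [unroll, hx'] at this
  · rintro h (_ | ⟨x, i⟩)
    · exact le_rfl
    · have : n x ≤ m x := h x
      simp only [unroll]
      split_ifs <;> omega

theorem unroll_bump (n : C.V → ℕ) (x : C.V) (hx : n x < K) :
    C.unroll K (bump n x) = bump (C.unroll K n) (some (x, ⟨n x, hx⟩)) := by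
  funext p
  by_cases hp : p = some (x, ⟨n x, hx⟩)
  · subst hp
    rw [bump_self]
    simp [unroll]
  · rw [bump_of_ne _ hp]
    rcases p with _ | ⟨y, i⟩
    · rfl
    · by_cases hy : y = x
      · subst hy
        have hi : i.val ≠ n y := fun h => hp (by rw [← Fin.eq_mk_iff_val_eq.2 h])
        simp only [unroll, bump_self]
        split_ifs <;> omega
      · simp only [unroll, bump_of_ne n hy]

theorem sum_unroll_mul_unrollWeight {n : C.V → ℕ} (hn : ∀ x, n x ≤ K) (x : C.V) (i : Fin K) :
    ∑ p, C.unroll K n (some p) * C.unrollWeight K p (x, i) =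
      (∑ y, n y * C.E y x) + if 0 < i.val ∧ i.val ≤ n x then C.linkWeight K else 0 := by
  classical
  simp only [unrollWeight, mul_add, Finset.sum_add_distrib]
  congr 1
  · rw [Fintype.sum_prod_type]
    refine Finset.sum_congr rfl fun y _ => ?_
    refine (Finset.sum_mul Finset.univ (fun j => C.unroll K n (some (y, j)))
      (C.E y x)).symm.trans ?_
    congr 1
    have h := Fin.sum_univ_eq_sum_range (fun j => if j < n y then 1 else 0) K
    refine h.trans ?_
    rw [Finset.sum_ite, Finset.sum_const_zero, add_zero, Finset.sum_const, smul_eq_mul, mul_one]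
    have : (Finset.range K).filter (· < n y) = Finset.range (n y) := by
      ext j
      have := hn y
      simp only [Finset.mem_filter, Finset.mem_range]
      omega
    rw [this, Finset.card_range]
  · by_cases hi : 0 < i.val
    · rw [Finset.sum_eq_single (x, (⟨i.val - 1, by omega⟩ : Fin K))]
      · have h1 : i.val - 1 + 1 = i.val := by omega
        simp only [unroll, h1, and_self, if_true, hi, true_and]
        have h2 : i.val - 1 < n x ↔ i.val ≤ n x := by omega
        simp [h2]
      · rintro ⟨y, j⟩ _ hne
        rw [if_neg, mul_zero]
        rintro ⟨rfl, h⟩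
        refine hne (Prod.ext rfl (Fin.ext ?_))
        change j.val = i.val - 1
        change j.val + 1 = i.val at h
        omega
      · simp
    · rw [if_neg fun h => hi h.1]
      refine Finset.sum_eq_zero fun p _ => ?_
      rw [if_neg, mul_zero]
      rintro ⟨-, h⟩
      change p.2.val + 1 = i.val at h
      omega

/-- The next vertex that can be fired in the unrolled game among the copies of `x` is the one with
index `n x`, provided that `x` can be fired in the original game. -/
theorem unrollThreshold_le_iff {n : C.V → ℕ} (hn : ∀ x, n x ≤ K) (x : C.V) (i : Fin K) :
    (C.unroll K n (some (x, i)) = 0 ∧ C.unrollThreshold K (x, i) ≤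
      ∑ p, C.unroll K n (some p) * C.unrollWeight K p (x, i)) ↔
        i.val = n x ∧ C.system.Enabled n x := by
  have hlt : ∑ y, n y * C.E y x < C.linkWeight K := by
    have h1 := Finset.single_le_sum (f := fun x => ∑ y, K * C.E y x) (fun _ _ => Nat.zero_le _)
      (Finset.mem_univ x)
    have h2 : ∑ y, n y * C.E y x ≤ ∑ y, K * C.E y x :=
      Finset.sum_le_sum fun y _ => Nat.mul_le_mul_right _ (hn y)
    unfold linkWeight
    omega
  have h0 : C.unroll K n (some (x, i)) = 0 ↔ n x ≤ i.val := by simp [unroll]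
  have hE : C.system.Enabled n x ↔ ¬ C.IsSink x ∧
    (n x + 1) * C.outDeg x ≤ C.init x + ∑ y, n y * C.E y x := Iff.rfl
  rw [sum_unroll_mul_unrollWeight hn, h0, hE, unrollThreshold]
  by_cases hs : C.IsSink x
  · simp only [hs, if_true, not_true, false_and, and_false, iff_false, not_and, not_le]
    intro _
    split_ifs <;> omega
  · simp only [hs, if_false, not_false_iff, true_and]
    constructor
    · rintro ⟨h1, h2⟩
      have hi : i.val = n x := by
        by_contra hne
        -- without the link from `(x, i - 1)` the vertex cannot collect `linkWeight` many chips
        rw [if_pos (by omega : 0 < i.val), if_neg (by omega)] at h2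
        omega
      refine ⟨hi, ?_⟩
      rw [← hi]
      split_ifs at h2 <;> omega
    · rintro ⟨hi, h2⟩
      rw [← hi] at h2 ⊢
      refine ⟨le_rfl, ?_⟩
      split_ifs <;> omega

theorem exists_unrollWeight_rank {r : C.V → ℕ} (hr : ∀ x y, 0 < C.E x y → r x < r y) :
    ∃ r' : C.V × Fin K → ℕ, ∀ p q, 0 < C.unrollWeight K p q → r' p < r' q := by
  -- lexicographic order: first the rank of the vertex, then the index of the copy
  refine ⟨fun p => r p.1 * K + p.2.val, ?_⟩
  rintro ⟨x, i⟩ ⟨y, j⟩ h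
  simp only [unrollWeight] at h ⊢
  rcases Nat.eq_zero_or_pos (C.E x y) with h0 | h0
  · have hxy : x = y ∧ i.val + 1 = j.val := by
      by_contra hne
      rw [h0, if_neg hne] at h
      exact lt_irrefl _ h
    rw [hxy.1]
    omega
  · have h1 : (r x + 1) * K ≤ r y * K := Nat.mul_le_mul_right K (hr x y h0)
    rw [add_mul] at h1
    omega

/-- An acyclic game is equivalent to every threshold game whose weights and thresholds express the
same conditions as those of the unrolled game. -/
theorem equivalent_thresholdGame {r : C.V → ℕ} (hr : ∀ x y, 0 < C.E x y → r x < r y)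
    (hK : ∀ n, C.system.Feasible n → ∀ x, n x ≤ K) (b : C.V × Fin K → C.V × Fin K → ℕ)
    (θ : C.V × Fin K → ℕ)
    (hb : ∀ n : C.V × Fin K → ℕ, (∀ p, n p ≤ 1) → ∀ q,
      (θ q ≤ ∑ p, n p * b p q ↔ C.unrollThreshold K q ≤ ∑ p, n p * C.unrollWeight K p q)) :
    C.Equivalent (thresholdGame b θ) := by
  have hfin : Finite C.system.State := State.finite_of_bounded hK
  have henabled : ∀ n, C.system.Feasible n → ∀ (x : C.V) (i : Fin K),
      (thresholdGame b θ).system.Enabled (C.unroll K n) (some (x, i)) ↔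
        i.val = n x ∧ C.system.Enabled n x := by
    intro n hn x i
    rw [thresholdGame.enabled_some_iff b θ (unroll_le_one n),
      hb (fun p => C.unroll K n (some p)) (fun p => unroll_le_one n _),
      unrollThreshold_le_iff (hK n hn)]
  obtain ⟨e⟩ : Nonempty (C.system.State ≃o (thresholdGame b θ).system.State) := by
    refine nonempty_state_orderIso (C.unroll K) unroll_zero
      (fun n m hn _ => unroll_le_iff (hK n hn)) ?_ ?_
    · intro n x hn hx
      have hlt : n x < K := by simpa using hK _ (hn.bump hx) x
      exact ⟨some (x, ⟨n x, hlt⟩), (henabled n hn x _).2 ⟨rfl, hx⟩, unroll_bump n x hlt⟩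
    · rintro n (_ | ⟨x, i⟩) hn h
      · exact absurd h (thresholdGame.not_enabled_none b θ _)
      · obtain ⟨hi, hx⟩ := (henabled n hn x i).1 h
        have hlt : n x < K := hi ▸ i.2
        obtain rfl : i = ⟨n x, hlt⟩ := Fin.ext hi
        exact ⟨x, hx, unroll_bump n x hlt⟩
  exact ⟨C.system.State, inferInstance,
    Generates.of_state_orderIso State.isULD (config_injOn_of_rank hr) (OrderIso.refl _),
    Generates.of_state_orderIso State.isULD (thresholdGame.config_injOn b θ) e.symm⟩

/-! ### Equivalent simple games and sandpile models -/

theorem IsAcyclic.exists_isSimple_equivalent (h : C.IsAcyclic) :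
    ∃ D : ChipFiringGame.{u}, D.IsAcyclic ∧ D.IsSimple ∧ C.Equivalent D := by
  obtain ⟨r, hr⟩ := h.exists_rank
  obtain ⟨K, hK⟩ := exists_bound hr
  obtain ⟨r', hr'⟩ := exists_unrollWeight_rank (K := K) hr
  exact ⟨thresholdGame (C.unrollWeight K) (C.unrollThreshold K), thresholdGame.isAcyclic r' hr',
    thresholdGame.isSimple _ _, equivalent_thresholdGame hr hK _ _ fun _ _ _ => Iff.rfl⟩

theorem IsAcyclic.exists_isASM_equivalent (h : C.IsAcyclic) :
    ∃ A : ChipFiringGame.{u}, A.IsASM ∧ C.Equivalent A := by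
  obtain ⟨r, hr⟩ := h.exists_rank
  obtain ⟨K, hK⟩ := exists_bound hr
  obtain ⟨r', hr'⟩ := exists_unrollWeight_rank (K := K) hr
  refine ⟨thresholdGame (symmWeight (C.unrollWeight K) r')
    (fun p => scale (C.unrollWeight K) r' p * C.unrollThreshold K p),
    thresholdGame.isASM fun p q => add_comm _ _,
    equivalent_thresholdGame hr hK _ _ fun n hn q => scale_mul_le_sum_symmWeight_iff hr' hn q _⟩

theorem Equivalent.generates {C D : ChipFiringGame.{u}} (h : C.Equivalent D) {L : Type v}
    [Lattice L] (hL : C.Generates L) : D.Generates L := by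
  obtain ⟨L', _, ⟨_, _, _, ⟨e₁⟩⟩, hD, _, _, ⟨e₂⟩⟩ := h
  obtain ⟨_, hfin, huld, ⟨e⟩⟩ := hL
  exact ⟨hD, hfin, huld, ⟨e₂.trans (e₁.symm.trans e)⟩⟩

end ChipFiringGame

theorem mainTheorem3 :
    (∀ C : ChipFiringGame.{u}, C.IsAcyclic →
      (∃ D : ChipFiringGame.{u}, D.IsAcyclic ∧ D.IsSimple ∧ C.Equivalent D) ∧
      (∃ A : ChipFiringGame.{u}, A.IsASM ∧ C.Equivalent A)) ∧
    (∀ (L : Type v) [Lattice L], MemLACFG.{u, v} L → MemLASM.{u, v} L) := by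
  refine ⟨fun C hC => ⟨hC.exists_isSimple_equivalent, hC.exists_isASM_equivalent⟩, ?_⟩
  rintro L _ ⟨C, hC, hL⟩
  obtain ⟨A, hA, h⟩ := hC.exists_isASM_equivalent
  exact ⟨A, hA, h.generates hL⟩
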